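/- \textbf{The game.} Let $G$ be a finite, simple, connected graph and $m\ge 1$. One cop plays against $m$ robbers with perfect information. In round $0$ the cop chooses a starting vertex, and then each robber chooses a starting vertex. In every later round the cop moves first and then all remaining robbers move; a move consists of staying at the current vertex or going to an adjacent one. Several players may occupy the same vertex. Whenever a robber occupies the same vertex as the cop, he is captured and leaves the game. The length of the game is the index of the round in which the last robber is captured. The capture time $\operatorname{capt}(G,m)$ is the minimum, over all strategies of the cop (which may depend on the course of the game), of the maximum length of the game over all possible behaviours of the robbers (it is infinite if no strategy of the cop guarantees the capture of all robbers in a bounded number of rounds). \textbf{The graphs $H(n)$, $n\ge 7$.} The graph $H(7)$ has vertex set $\{1,\dots,7\}$ and consists of the path $6,2,1,4$, two vertices $5$ and $3$ each adjacent to all four vertices $6,2,1,4$ (but not to each other), and a vertex $7$ adjacent to exactly $6$, $4$ and $3$. For $n\ge 8$, $H(n)$ is obtained from $H(n-1)$ by adding a vertex $n$ adjacent to exactly $n-1$, $n-3$ and $n-4$. \textbf{Theorem.} Let $\ell\ge 2$ be an integer and $n=4\ell+2$. Then the capture time of $H(n)$ with one cop and three robbers is $$\operatorname{capt}(H(n),3)=2\ell+3(n-4).$$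 -/

import Mathlib

/-! The game of one cop and `m` robbers with consecutive captures, its capture time, and the
graphs `H(n)`. -/

namespace CopsRobbers

/-- A legal move in the (reflexive) graph `G`: stay, or go to an adjacent vertex. -/
def Step {V : Type*} (G : SimpleGraph V) (u v : V) : Prop :=
  v = u ∨ G.Adj u v

/-- A position of the game with one cop and `m` robbers; `robber i = none` means that the
`i`-th robber has been captured (and no longer plays). -/
structure Position (V : Type*) (m : ℕ) where
  cop : V
  robber : Fin m → Option V

open Classical in
/-- The status of a robber standing at `v` when the cop is at `c`: captured if `v = c`. -/
noncomputable def status {V : Type*} (c v : V) : Option V :=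
  if v = c then none else some v

/-- A strategy of the cop: a starting vertex, and a legal move in every position, which may
depend on all the earlier positions of the game (listed in `past`). -/
structure CopStrategy {V : Type*} (G : SimpleGraph V) (m : ℕ) where
  start : V
  move : (past : List (Position V m)) → (now : Position V m) → V
  legal : ∀ past now, Step G now.cop (move past now)

/-- The robber's part of a round, the cop having just moved to `c`. A captured robber stays
captured; a robber at the vertex `c` is captured; any other robber moves from `v` to some `w`
(and is captured if `w = c`). -/
def RobberMove {V : Type*} (G : SimpleGraph V) (c : V) : Option V → Option V → Prop
  | none, r' => r' = none
  | some v, r' => (v = c ∧ r' = none) ∨ (v ≠ c ∧ ∃ w, Step G v w ∧ r' = status c w)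

/-- `p 0, p 1, p 2, …`, where `p t` is the position at the end of round `t`, is a play of the
game in which the cop follows `σ`. In round 0 the cop takes her starting vertex and then every
robber chooses a vertex; in each later round the cop moves and then the remaining robbers move. -/
structure IsPlay {V : Type*} {G : SimpleGraph V} {m : ℕ} (σ : CopStrategy G m)
    (p : ℕ → Position V m) : Prop where
  cop_zero : (p 0).cop = σ.start
  robber_zero : ∀ i, ∃ v, (p 0).robber i = status σ.start v
  cop_succ : ∀ t, (p (t + 1)).cop = σ.move ((List.range t).map p) (p t)
  robber_succ : ∀ t i, RobberMove G (p (t + 1)).cop ((p t).robber i) ((p (t + 1)).robber i)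

/-- The length of a play: the first round at the end of which all robbers are captured
(`⊤` if there is none). -/
noncomputable def playLength {V : Type*} {m : ℕ} (p : ℕ → Position V m) : ℕ∞ :=
  ⨅ (t : ℕ) (_ : ∀ i, (p t).robber i = none), (t : ℕ∞)

/-- The capture time of `G` with one cop and `m` robbers: the cop minimizes, over all her
strategies, the maximal length of a play against that strategy. -/
noncomputable def captureTime {V : Type*} (G : SimpleGraph V) (m : ℕ) : ℕ∞ :=
  ⨅ σ : CopStrategy G m, ⨆ (p : ℕ → Position V m) (_ : IsPlay σ p), playLength p

/-- The edges of `H(7)`: the path `6, 2, 1, 4`, the vertices `5` and `3` adjacent to all of the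
path, and the vertex `7` adjacent to `6`, `4` and `3`. -/
def edgesH7 : List (ℕ × ℕ) :=
  [(6, 2), (2, 1), (1, 4),
   (5, 6), (5, 2), (5, 1), (5, 4),
   (3, 6), (3, 2), (3, 1), (3, 4),
   (7, 6), (7, 4), (7, 3)]

/-- The graph `H(n)` (for `n ≥ 7`) on the vertex set `{1, …, n}`: the edges of `H(7)`, and for
every vertex `b ≥ 8` the edges from `b` to `b - 1`, `b - 3` and `b - 4`. -/
def graphH (n : ℕ) : SimpleGraph (Set.Icc 1 n : Set ℕ) :=
  SimpleGraph.fromRel fun a b =>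
    ((a : ℕ), (b : ℕ)) ∈ edgesH7 ∨
      (8 ≤ (b : ℕ) ∧ ((a : ℕ) + 1 = b ∨ (a : ℕ) + 3 = b ∨ (a : ℕ) + 4 = b))

end CopsRobbers

/-! Apart from the edge 13, adjacency in `H(n)` means a difference of 1, 3 or 4, so a move along any
other edge shifts the residue mod 4 by at most 1. A robber above the cop whose difference from her
is 2 mod 4 can mirror her moves; only 13, which shifts residues by 2, breaks this. Once the cop
stands at a lower vertex of the robber's residue class (his shadow), she regains the shadow after
each of his moves, but he can limit her advance to one vertex per round. From 2 the capture of one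
robber thus takes at most `n - 4` rounds (`Doomed`).

Upper bound: the cop chases one robber from 2, returns to 2 within `ℓ` rounds, and repeats; no
return follows the last capture, which gives `3 * (n - 4) + 2 * ℓ`.

Lower bound: `Safe` bounds one robber's survival from below. Its term `(c + 1) / 4` is the distance
from `c` to {1, 2}, which a cop not in shadow play must still travel. The robbers move as one until
the cop reaches `n - 4` with all of them at `n`. They then spread over `n - 3`, `n - 1`, `n`, so
that she captures at most one of them; the others regroup at a vertex safe for `n - 4 + ℓ` rounds,
since `(d + 1) / 4 = ℓ` for each of these three positions `d` of the cop. -/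

namespace CopsRobbers

/-! ### Capture time by backward induction on positions -/

section Strategies

variable {V : Type*} {G : SimpleGraph V} {m : ℕ}

/-- The cop, to move in the position `p`, can capture all robbers within `k` more rounds. -/
def CopWins (G : SimpleGraph V) : ℕ → Position V m → Prop
  | 0, p => ∀ i, p.robber i = none
  | k + 1, p => (∀ i, p.robber i = none) ∨ ∃ c, Step G p.cop c ∧ ∀ p' : Position V m, p'.cop = c →
      (∀ i, RobberMove G c (p.robber i) (p'.robber i)) → CopWins G k p'

theorem copWins_of_forall_none {p : Position V m} (h : ∀ i, p.robber i = none) :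
    ∀ k, CopWins G k p
  | 0 => h
  | _ + 1 => Or.inl h

theorem CopWins.succ : ∀ {k : ℕ} {p : Position V m}, CopWins G k p → CopWins G (k + 1) p
  | 0, _, h => Or.inl h
  | _ + 1, _, Or.inl h => Or.inl h
  | _ + 1, _, Or.inr ⟨c, hc, h⟩ => Or.inr ⟨c, hc, fun p' hp hr => (h p' hp hr).succ⟩

theorem CopWins.mono {j k : ℕ} (hjk : j ≤ k) {p : Position V m} (h : CopWins G j p) :
    CopWins G k p := by
  induction hjk with
  | refl => exact h
  | step _ ih => exact ih.succ

theorem exists_robberMove (c : V) (r : Option V) : ∃ r', RobberMove G c r r' := by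
  cases r with
  | none => exact ⟨none, rfl⟩
  | some v =>
    by_cases h : v = c
    · exact ⟨none, Or.inl ⟨h, rfl⟩⟩
    · exact ⟨status c v, Or.inr ⟨h, v, Or.inl rfl, rfl⟩⟩

/-- The initial positions of the game in which the cop starts at `s`. -/
def IsInitial (s : V) (p : Position V m) : Prop :=
  p.cop = s ∧ ∀ i, ∃ v, p.robber i = status s v

/-- Playing for the least winning budget gives one move that serves every `k`, hence a strategy that
ignores the past. -/
theorem exists_descending_move (p : Position V m) :
    ∃ c, Step G p.cop c ∧ ∀ k, CopWins G k p → (∃ i, p.robber i ≠ none) →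
      ∀ p' : Position V m, p'.cop = c → (∀ i, RobberMove G c (p.robber i) (p'.robber i)) →
        ∃ j < k, CopWins G j p' := by
  classical
  by_cases h : (∃ k, CopWins G k p) ∧ ∃ i, p.robber i ≠ none
  · obtain ⟨hk, i, hi⟩ := h
    have hs := Nat.find_spec hk
    have hm : ∀ k, CopWins G k p → Nat.find hk ≤ k := fun k hk' => Nat.find_min' hk hk'
    generalize Nat.find hk = j at hs hm
    cases j with
    | zero => exact absurd (hs i) hi
    | succ j =>
      rcases hs with hs | ⟨c, hc, hs⟩
      · exact absurd (hs i) hi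
      · exact ⟨c, hc, fun k hk' _ p' hp hr => ⟨j, hm k hk', hs p' hp hr⟩⟩
  · exact ⟨p.cop, Or.inl rfl, fun k hk hi => absurd ⟨⟨k, hk⟩, hi⟩ h⟩

theorem captureTime_le {k : ℕ} (s : V)
    (h : ∀ p : Position V m, IsInitial s p → CopWins G k p) : captureTime G m ≤ k := by
  choose mv hmv hdesc using fun p : Position V m => exists_descending_move (G := G) p
  refine iInf_le_of_le ⟨s, fun _ now => mv now, fun _ now => hmv now⟩ (iSup₂_le fun p hp => ?_)
  have key : ∀ k t, CopWins G k (p t) → ∃ u ≤ t + k, ∀ i, (p u).robber i = none := by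
    intro k
    induction k using Nat.strong_induction_on with
    | _ k ih =>
      intro t ht
      by_cases hi : ∃ i, (p t).robber i ≠ none
      · obtain ⟨j, hj, hw⟩ := hdesc (p t) k ht hi (p (t + 1)) (hp.cop_succ t) (by
          intro i
          have := hp.robber_succ t i
          rwa [hp.cop_succ t] at this)
        obtain ⟨u, hu, hn⟩ := ih j hj (t + 1) hw
        exact ⟨u, by omega, hn⟩
      · push Not at hi
        exact ⟨t, by omega, hi⟩
  obtain ⟨u, hu, hn⟩ := key k 0 (h (p 0) ⟨hp.cop_zero, hp.robber_zero⟩)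
  exact (iInf₂_le u hn).trans (by exact_mod_cast (by omega : u ≤ k))

theorem exists_robber_response (σ : CopStrategy G m) (k : ℕ) (past : List (Position V m))
    (p : Position V m) :
    ∃ p' : Position V m, p'.cop = σ.move past p ∧
      (∀ i, RobberMove G p'.cop (p.robber i) (p'.robber i)) ∧
      (¬ CopWins G (k + 1) p → ¬ CopWins G k p') := by
  by_cases h : CopWins G (k + 1) p
  · choose r hr using fun i => exists_robberMove (G := G) (σ.move past p) (p.robber i)
    exact ⟨⟨σ.move past p, r⟩, rfl, hr, fun h' => absurd h h'⟩
  · have h' := h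
    simp only [CopWins, not_or, not_exists, not_and, not_forall] at h'
    obtain ⟨p', hp, hr, hw⟩ := h'.2 _ (σ.legal past p)
    exact ⟨p', hp, by rwa [hp], fun _ => hw⟩

/-- The strategy `σ` may use the history, so a play is built against it round by round, keeping the
cop outside `CopWins` for the remaining budget. -/
theorem lt_captureTime {k : ℕ}
    (h : ∀ s : V, ∃ p : Position V m, IsInitial s p ∧ ¬ CopWins G k p) :
    (k : ℕ∞) < captureTime G m := by
  by_contra hle
  rw [not_lt] at hle
  have hlt : captureTime G m < ((k + 1 : ℕ) : ℕ∞) :=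
    hle.trans_lt (by exact_mod_cast Nat.lt_succ_self k)
  obtain ⟨σ, hσ⟩ := iInf_lt_iff.1 hlt
  obtain ⟨p₀, hp₀, hw₀⟩ := h σ.start
  choose next hcop hrob hnext using exists_robber_response σ
  -- The recursion carries the list of past positions, because `σ` reads it.
  let S : ℕ → List (Position V m) × Position V m := fun t =>
    Nat.rec ([], p₀) (fun t s => (s.1 ++ [s.2], next (k - (t + 1)) s.1 s.2)) t
  let p : ℕ → Position V m := fun t => (S t).2
  have hpast : ∀ t, (S t).1 = (List.range t).map p := by
    intro t
    induction t with
    | zero => rfl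
    | succ t ih =>
      rw [List.range_succ, List.map_append, ← ih]
      rfl
  have hplay : IsPlay σ p :=
    { cop_zero := hp₀.1
      robber_zero := hp₀.2
      cop_succ := fun t => by
        rw [← hpast t]
        exact hcop _ _ _
      robber_succ := fun t => hrob _ _ _ }
  have hlose : ∀ t ≤ k, ¬ CopWins G (k - t) (p t) := by
    intro t
    induction t with
    | zero => exact fun _ => hw₀
    | succ t ih =>
      intro ht
      refine hnext _ _ _ ?_
      have := ih (by omega)
      rwa [show k - t = k - (t + 1) + 1 by omega] at this
  have hlen : ((k + 1 : ℕ) : ℕ∞) ≤ playLength p := by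
    refine le_iInf₂ fun t ht => ?_
    by_contra hc
    have hc' : t < k + 1 := by exact_mod_cast not_le.1 hc
    exact hlose t (by omega) (copWins_of_forall_none ht _)
  exact absurd (hlen.trans (le_iSup₂_of_le p hplay le_rfl)) (not_le.2 hσ)

end Strategies

/-! ### Adjacency through differences of labels -/

/-- Being equal or adjacent in the graphs `H(n)`. -/
def Near (a b : ℕ) : Prop :=
  a = b ∨ a + 1 = b ∨ a + 3 = b ∨ a + 4 = b ∨ b + 1 = a ∨ b + 3 = a ∨ b + 4 = a ∨
    (a = 1 ∧ b = 3) ∨ (a = 3 ∧ b = 1)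

instance (a b : ℕ) : Decidable (Near a b) := by
  unfold Near
  infer_instance

theorem le_seven_of_mem_edgesH7 {a b : ℕ} (h : (a, b) ∈ edgesH7) : a ≤ 7 ∧ b ≤ 7 := by
  have : ∀ e ∈ edgesH7, e.1 ≤ 7 ∧ e.2 ≤ 7 := by decide
  exact this _ h

theorem mem_edgesH7_iff : ∀ a < 8, ∀ b < 8, 1 ≤ a → 1 ≤ b → a ≠ b →
    ((a, b) ∈ edgesH7 ∨ (b, a) ∈ edgesH7 ↔ Near a b) := by
  intro a ha b hb ha' hb' hab
  interval_cases a <;> interval_cases b <;> first | exact absurd rfl hab | decide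

/-- `H(7)` already follows the difference pattern 1, 3, 4 of the later vertices, with 13 as its only
extra edge. -/
theorem step_graphH_iff {n : ℕ} (a b : (Set.Icc 1 n : Set ℕ)) :
    Step (graphH n) a b ↔ Near a b := by
  obtain ⟨a, ha, ha'⟩ := a
  obtain ⟨b, hb, hb'⟩ := b
  simp only [Step, graphH, SimpleGraph.fromRel_adj, Subtype.ext_iff, ne_eq]
  by_cases hab : a = b
  · subst hab
    simp [Near]
  by_cases h7 : a ≤ 7 ∧ b ≤ 7
  · rw [← mem_edgesH7_iff a (by omega) b (by omega) ha hb hab]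
    constructor
    · rintro (h | ⟨_, (h | h) | (h | h)⟩)
      · exact absurd h.symm hab
      · exact Or.inl h
      · omega
      · exact Or.inr h
      · omega
    · rintro (h | h)
      · exact Or.inr ⟨hab, Or.inl (Or.inl h)⟩
      · exact Or.inr ⟨hab, Or.inr (Or.inl h)⟩
  · have h1 : (a, b) ∉ edgesH7 := fun h => h7 (le_seven_of_mem_edgesH7 h)
    have h2 : (b, a) ∉ edgesH7 := fun h => h7 (le_seven_of_mem_edgesH7 h).symm
    simp only [h1, h2, false_or, Near]
    constructor
    · omega
    · intro h
      refine Or.inr ⟨hab, ?_⟩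
      omega

/-! ### Lower bound: evasion by a single robber -/

/-- A single robber at `r`, not near the cop at `c` who is to move, can stay uncaptured for
`v - 1` more rounds. -/
inductive Safe (n c r v : ℕ) : Prop
  | twoBelow (hr : 2 ≤ r := by omega) (hc : r + 2 = c := by omega)
      (hv : v + 4 ≤ n + (c + 1) / 4 := by omega)
  | farBelow (hc : r + 5 ≤ c := by omega) (hv : v + 4 ≤ n + (c + 1) / 4 := by omega)
  | twoAbove (hc : 2 ≤ c := by omega) (hr : c + 2 ≤ r := by omega)
      (hm : (r - c) % 4 = 2 := by omega) (hv : v + 4 ≤ n + (c + 1) / 4 := by omega)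
  | sixAbove (hc : c = 1 := by omega) (hr : 7 ≤ r := by omega)
      (hm : r % 4 = 3 := by omega) (hv : v + 5 ≤ n := by omega)
  | fiveAbove (hr : c + 5 ≤ r := by omega) (hm : (r - c) % 4 = 1 := by omega)
      (hv : v + c + 3 ≤ n := by omega)
  | sevenAbove (hr : c + 7 ≤ r := by omega) (hm : (r - c) % 4 = 3 := by omega)
      (hv : v + c + 5 ≤ n := by omega)
  | eightAbove (hr : c + 8 ≤ r := by omega) (hm : (r - c) % 4 = 0 := by omega)
      (hv : v + c + 6 ≤ n := by omega)

theorem Safe.not_near {n c r v : ℕ} (h : Safe n c r v) : ¬ Near c r := by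
  unfold Near
  rcases h <;> omega

/-- A robber at `r` can move so that he is safe for `v` when the cop is at `d`. -/
inductive CanEscape (n d r v : ℕ) : Prop
  | mk (s : ℕ) (h : Safe n d s v) (hs : 1 ≤ s := by omega) (hs' : s ≤ n := by omega)
      (hrs : Near r s := by unfold Near; omega)

/-- Whatever the move of the cop, a safe robber can lose at most one round. -/

theorem Safe.canEscape {n c r v d : ℕ} (hn : 10 ≤ n) (hc₁ : 1 ≤ c) (hc' : c ≤ n) (hd : 1 ≤ d)
    (hr₁ : 1 ≤ r) (hr' : r ≤ n) (hv₂ : 2 ≤ v) (h : Safe n c r (v + 1))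
    (hcd : Near c d) : CanEscape n d r v := by
  cases h with
  | twoBelow hr hc hv =>
    rcases hcd with h | h | h | h | h | h | h | h | h
    · exact .mk r .twoBelow
    · exact .mk (r + 1) .twoBelow
    · exact .mk r .farBelow
    · exact .mk r .farBelow
    · rcases hr.eq_or_lt with h' | h'
      · exact .mk (r + 3) .twoAbove
      · exact .mk (r - 1) .twoBelow
    · rcases hd.eq_or_lt with h' | h'
      · exact .mk (r + 4) .fiveAbove
      · exact .mk (r + 1) .twoAbove
    · rcases hd.eq_or_lt with h' | h'
      · exact .mk (r + 3) .fiveAbove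
      · exact .mk r .twoAbove
    · omega
    · omega
  | farBelow hc hv =>
    have far : r + 5 ≤ d → v + 4 ≤ n + (d + 1) / 4 → CanEscape n d r v :=
      fun h _ => .mk r .farBelow
    have near : d ≤ r + 4 → r + 1 ≤ d → d ≤ n → v + 4 ≤ n + (d + 1) / 4 → (r = 1 → d ≠ 2) →
        (d = r + 1 → d + 2 ≤ n) → CanEscape n d r v := by
      intro h1 h2 h3 h4 h5 h6
      obtain h | h | h | h : d = r + 1 ∨ d = r + 2 ∨ d = r + 3 ∨ d = r + 4 := by omega
      · exact .mk (r + 3) .twoAbove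
      · rcases hr₁.eq_or_lt with h' | h'
        · exact .mk (r + 4) .twoAbove
        · exact .mk r .twoBelow
      · exact .mk (r + 1) .twoBelow
      · rcases hr₁.eq_or_lt with h' | h'
        · exact .mk 3 .twoBelow
        · exact .mk (r - 1) .farBelow
    by_cases hrd : r + 5 ≤ d
    · exact far hrd (by unfold Near at hcd; omega)
    · by_cases h2 : r = 1 ∧ d = 2
      · exact .mk 4 (.twoAbove (hv := by unfold Near at hcd; omega))
      · unfold Near at hcd
        exact near (by omega) (by omega) (by omega) (by omega) (by omega) (by omega)
  | twoAbove hc hr hm hv =>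
    rcases hcd with h | h | h | h | h | h | h | h | h
    · exact .mk r .twoAbove
    · rcases hr'.eq_or_lt with h' | h'
      · rcases hr.eq_or_lt with h'' | h''
        · exact .mk (r - 3) .twoBelow
        · exact .mk (r - 3) .twoAbove
      · exact .mk (r + 1) .twoAbove
    · rcases hr.eq_or_lt with h'' | h''
      · exact .mk (r - 1) .twoBelow
      · exact .mk (r - 1) .twoAbove
    · rcases hr.eq_or_lt with h'' | h''
      · exact .mk r .twoBelow
      · exact .mk r .twoAbove
    · rcases hd.eq_or_lt with h' | h'
      · rcases hr.eq_or_lt with h'' | h''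
        · exact .mk (r + 3) .sixAbove
        · exact .mk (r - 1) .sixAbove
      · exact .mk (r - 1) .twoAbove
    · rcases hd.eq_or_lt with h' | h'
      · exact .mk r .fiveAbove
      · exact .mk (r - 3) .twoAbove
    · rcases hd.eq_or_lt with h' | h'
      · exact .mk (r - 1) .fiveAbove
      · exact .mk r .twoAbove
    · omega
    · rcases hr'.eq_or_lt with h' | h'
      · exact .mk (r - 3) .fiveAbove
      · exact .mk (r + 1) .fiveAbove
  | sixAbove hc hr hm hv =>
    rcases hcd with h | h | h | h | h | h | h | h | h
    · exact .mk r .sixAbove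
    · exact .mk r .fiveAbove
    · exact .mk (r - 1) .twoAbove
    · exact .mk r .twoAbove
    · omega
    · omega
    · omega
    · rcases hr'.eq_or_lt with h' | h'
      · exact .mk (r - 3) .fiveAbove
      · exact .mk (r + 1) .fiveAbove
    · omega
  | fiveAbove hr hm hv =>
    rcases hcd with h | h | h | h | h | h | h | h | h
    · exact .mk r .fiveAbove
    · rcases hr'.eq_or_lt with h' | h'
      · exact .mk (r - 3) .fiveAbove
      · exact .mk (r + 1) .fiveAbove
    · exact .mk r .twoAbove
    · rcases hr'.eq_or_lt with h' | h'
      · rcases hr.eq_or_lt with h'' | h''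
        · exact .mk (r - 3) .twoBelow
        · exact .mk (r - 3) .twoAbove
      · exact .mk (r + 1) .twoAbove
    · rcases hd.eq_or_lt with h' | h'
      · exact .mk r .sixAbove
      · exact .mk r .twoAbove
    · exact .mk r .eightAbove
    · exact .mk r .fiveAbove
    · exact .mk (r - 1) .twoAbove
    · exact .mk r .sevenAbove
  | sevenAbove hr hm hv =>
    rcases hcd with h | h | h | h | h | h | h | h | h
    · exact .mk r .sevenAbove
    · exact .mk r .twoAbove
    · rcases hr'.eq_or_lt with h' | h'
      · exact .mk (r - 3) .fiveAbove
      · exact .mk (r + 1) .fiveAbove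
    · exact .mk (r - 1) .twoAbove
    · exact .mk r .eightAbove
    · rcases hd.eq_or_lt with h' | h'
      · exact .mk r .sixAbove
      · exact .mk r .twoAbove
    · exact .mk r .sevenAbove
    · exact .mk r .fiveAbove
    · exact .mk r .fiveAbove
  | eightAbove hr hm hv =>
    rcases hcd with h | h | h | h | h | h | h | h | h
    · exact .mk r .eightAbove
    · exact .mk (r - 1) .twoAbove
    · exact .mk r .fiveAbove
    · rcases hr'.eq_or_lt with h' | h'
      · exact .mk (r - 3) .fiveAbove
      · exact .mk (r + 1) .fiveAbove
    · exact .mk r .fiveAbove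
    · exact .mk r .sevenAbove
    · exact .mk r .eightAbove
    · exact .mk r .twoAbove
    · rcases hd.eq_or_lt with h' | h'
      · exact .mk r .sixAbove
      · omega

/-- A robber who is safe for just two rounds is at the last vertex. -/

theorem Safe.eq_last {n c r : ℕ} (hn : 10 ≤ n) (hr' : r ≤ n) (h : Safe n c r 2)
    (h' : ¬ Safe n c r 3) : r = n ∧ (c + 5 = n ∨ c + 7 = n ∨ c + 8 = n) := by
  by_contra hne
  apply h'
  cases h with
  | twoBelow => exact .twoBelow
  | farBelow => exact .farBelow
  | twoAbove => exact .twoAbove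
  | sixAbove => exact .sixAbove
  | fiveAbove => exact .fiveAbove
  | sevenAbove => exact .sevenAbove
  | eightAbove => exact .eightAbove

/-- Away from the last five vertices the robbers at the last vertex can stay uncaptured. -/

theorem canEscape_last {n c d : ℕ} (hn : 10 ≤ n) (hc : c + 5 = n ∨ c + 7 = n ∨ c + 8 = n)
    (hd : 1 ≤ d) (hcd : Near c d) (hdn : d + 4 ≠ n) : CanEscape n d n 2 := by
  have h : d + 1 = n ∨ d + 2 = n ∨ d + 3 = n ∨ d + 5 = n ∨ d + 6 = n ∨ d + 7 = n ∨ d + 8 = n ∨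
      d + 9 = n ∨ d + 10 = n ∨ d + 11 = n ∨ d + 12 = n := by
    unfold Near at hcd
    omega
  rcases h with h | h | h | h | h | h | h | h | h | h | h
  · exact .mk (n - 3) .twoBelow
  · exact .mk n .twoAbove
  · exact .mk (n - 1) .twoAbove
  · exact .mk n .fiveAbove
  · exact .mk n .twoAbove
  · exact .mk n .sevenAbove
  · exact .mk n .eightAbove
  · exact .mk n .fiveAbove
  · exact .mk (n - 1) .fiveAbove
  · exact .mk n .sevenAbove
  · exact .mk n .eightAbove

/-- For each position of the cop there is a vertex at which a robber is safe for `n - 4` rounds. -/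

theorem exists_safe {n c : ℕ} (hn : 10 ≤ n) (hc : 1 ≤ c) (hc' : c ≤ n) :
    ∃ r, 1 ≤ r ∧ r ≤ n ∧ Safe n c r (n - 4) := by
  by_cases h1 : c = 1
  · exact ⟨6, by omega, by omega, .fiveAbove⟩
  by_cases h4 : 4 ≤ c
  · exact ⟨c - 2, by omega, by omega, .twoBelow⟩
  · exact ⟨c + 2, by omega, by omega, .twoAbove⟩

/-! ### Lower bound: several robbers acting together -/

section Arrangement

variable {V : Type*} {G : SimpleGraph V} {m : ℕ}

/-- The position with the cop at `c` in which the robbers `i ∈ A` are still free, at `f i`. -/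
def arrangement (c : V) (A : Finset (Fin m)) (f : Fin m → V) : Position V m where
  cop := c
  robber i := if i ∈ A then some (f i) else none

theorem not_copWins_zero_arrangement {c : V} {A : Finset (Fin m)} {f : Fin m → V}
    (hA : A.Nonempty) : ¬ CopWins G 0 (arrangement c A f) := by
  obtain ⟨i, hi⟩ := hA
  intro h
  have := h i
  simp [arrangement, hi] at this

theorem not_copWins_succ_arrangement {k : ℕ} {c : V} {A : Finset (Fin m)} {f : Fin m → V}
    (hA : A.Nonempty)
    (h : ∀ d, Step G c d → ∃ (B : Finset (Fin m)) (g : Fin m → V),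
      (∀ i, i ∈ B ↔ i ∈ A ∧ f i ≠ d) ∧ (∀ i ∈ B, Step G (f i) (g i) ∧ g i ≠ d) ∧
        ¬ CopWins G k (arrangement d B g)) :
    ¬ CopWins G (k + 1) (arrangement c A f) := by
  rintro (h0 | ⟨d, hd, hw⟩)
  · exact not_copWins_zero_arrangement (G := G) hA h0
  · obtain ⟨B, g, hB, hg, hn⟩ := h d hd
    refine hn (hw _ rfl fun i => ?_)
    by_cases hi : i ∈ A
    · by_cases hf : f i = d
      · have : i ∉ B := fun hiB => ((hB i).1 hiB).2 hf
        simp [arrangement, hi, this, RobberMove, hf]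
      · have hiB : i ∈ B := (hB i).2 ⟨hi, hf⟩
        simp only [arrangement, hi, hiB, if_true, RobberMove]
        exact Or.inr ⟨hf, g i, (hg i hiB).1, by simp [status, (hg i hiB).2]⟩
    · have : i ∉ B := fun hiB => hi ((hB i).1 hiB).1
      simp [arrangement, hi, this, RobberMove]

end Arrangement

/-- Robbers who are all at a vertex safe for `v` rounds, or spread over the three vertices
`n - 3`, `n - 1`, `n` with the cop at `n - 4`, resist long. -/

theorem not_copWins_graphH {n ℓ : ℕ} (hℓ : 2 ≤ ℓ) (hn : n = 4 * ℓ + 2) (k : ℕ) :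
    (∀ (c r : (Set.Icc 1 n : Set ℕ)) (A : Finset (Fin 3)) (v : ℕ), A.Nonempty → 2 ≤ v →
      Safe n c r v → k < v + (A.card - 1) * (n - 4 + ℓ) →
        ¬ CopWins (graphH n) k (arrangement c A fun _ => r)) ∧
    (∀ (c : (Set.Icc 1 n : Set ℕ)) (A : Finset (Fin 3)) (f : Fin 3 → (Set.Icc 1 n : Set ℕ)),
      (c : ℕ) + 4 = n → A.Nonempty → Function.Injective f →
      (∀ i, (f i : ℕ) + 3 = n ∨ (f i : ℕ) + 1 = n ∨ (f i : ℕ) = n) →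
      k < 1 + (A.card - 1) * (n - 4 + ℓ) → ¬ CopWins (graphH n) k (arrangement c A f)) := by
  have ne_of_safe : ∀ {c r : (Set.Icc 1 n : Set ℕ)} {v : ℕ}, Safe n c r v → r ≠ c := by
    rintro c r v h rfl
    exact h.not_near (Or.inl rfl)
  induction k with
  | zero =>
    exact ⟨fun _ _ _ _ hA _ _ _ => not_copWins_zero_arrangement hA,
      fun _ _ _ _ hA _ _ _ => not_copWins_zero_arrangement hA⟩
  | succ k ih =>
    obtain ⟨ih₁, ih₂⟩ := ih
    constructor
    · intro c r A v hA hv hs hk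
      obtain ⟨hc, hc'⟩ := c.2
      obtain ⟨hr, hr'⟩ := r.2
      refine not_copWins_succ_arrangement hA fun d hd => ?_
      rw [step_graphH_iff] at hd
      obtain ⟨hd₁, hd'⟩ := d.2
      have hrd : r ≠ d := by
        rintro rfl
        exact hs.not_near hd
      have together : ∀ u, 2 ≤ u → v ≤ u + 1 → CanEscape n d r u →
          ∃ (B : Finset (Fin 3)) (g : Fin 3 → (Set.Icc 1 n : Set ℕ)),
            (∀ i, i ∈ B ↔ i ∈ A ∧ r ≠ d) ∧ (∀ i ∈ B, Step (graphH n) r (g i) ∧ g i ≠ d) ∧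
              ¬ CopWins (graphH n) k (arrangement d B g) := by
        rintro u hu huv ⟨s, hsafe, hs1, hsn, hnear⟩
        refine ⟨A, fun _ => ⟨s, hs1, hsn⟩, fun i => by simp [hrd], fun i _ => ⟨?_, ?_⟩, ?_⟩
        · exact (step_graphH_iff _ _).2 hnear
        · exact ne_of_safe hsafe
        · exact ih₁ d ⟨s, hs1, hsn⟩ A u hA hu hsafe (by omega)
      rcases hv.eq_or_lt with rfl | hv
      · by_cases h3 : Safe n c r 3
        · exact together 2 le_rfl (by omega)
            (h3.canEscape (by omega) hc hc' hd₁ hr hr' le_rfl hd)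
        · obtain ⟨hrn, hcn⟩ := hs.eq_last (by omega) hr' h3
          by_cases hdn : (d : ℕ) + 4 = n
          -- The cop at `n - 4` dominates all neighbours of `n`, so nobody can get out of her reach.
          -- Occupying three distinct vertices limits her next move to one capture.
          · let f : Fin 3 → (Set.Icc 1 n : Set ℕ) :=
              ![⟨n - 3, by omega, by omega⟩, ⟨n - 1, by omega, by omega⟩,
                ⟨n, by omega, by omega⟩]
            have hf : ∀ i, (f i : ℕ) + 3 = n ∨ (f i : ℕ) + 1 = n ∨ (f i : ℕ) = n := by
              intro i
              fin_cases i <;> simp [f] <;> omega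
            have hinj : Function.Injective f := by
              intro i j hij
              have := congrArg Subtype.val hij
              fin_cases i <;> fin_cases j <;> simp [f] at this ⊢ <;> omega
            refine ⟨A, f, fun i => by simp [hrd], fun i _ => ⟨?_, fun h => ?_⟩,
              ih₂ d A f hdn hA hinj hf (by omega)⟩
            · rw [step_graphH_iff, hrn]
              have := hf i
              unfold Near
              omega
            · have := hf i
              rw [h] at this
              omega
          · refine together 2 le_rfl (by omega) ?_
            rw [hrn]
            exact canEscape_last (by omega) hcn hd₁ hd hdn
      · obtain ⟨u, rfl⟩ : ∃ u, v = u + 1 := ⟨v - 1, by omega⟩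
        exact together u (by omega) le_rfl
          (hs.canEscape (by omega) hc hc' hd₁ hr hr' (by omega) hd)
    · intro c A f hcn hA hinj hf hk
      refine not_copWins_succ_arrangement hA fun d hd => ?_
      rw [step_graphH_iff] at hd
      obtain ⟨hd₁, hd'⟩ := d.2
      by_cases hcap : (d : ℕ) + 3 = n ∨ (d : ℕ) + 1 = n ∨ (d : ℕ) = n
      -- `s` is a common meeting point for the survivors. As `n = 4 * ℓ + 2`, the cop at `n - 3`, `n
      -- - 1` or `n` has `(d + 1) / 4 = ℓ`.
      · obtain ⟨s, hs1, hsn, hsafe, hnear⟩ : ∃ s, 1 ≤ s ∧ s ≤ n ∧ Safe n d s (n - 4 + ℓ) ∧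
            ∀ i, f i ≠ d → Near (f i) s := by
          have hne : ∀ i, f i ≠ d → (f i : ℕ) ≠ d := fun i h h' => h (Subtype.ext h')
          rcases hcap with h | h | h
          · refine ⟨n - 1, by omega, by omega, .twoAbove, fun i hi => ?_⟩
            have := hf i
            have := hne i hi
            unfold Near
            omega
          · refine ⟨n - 3, by omega, by omega, .twoBelow, fun i hi => ?_⟩
            have := hf i
            have := hne i hi
            unfold Near
            omega
          · refine ⟨n - 2, by omega, by omega, .twoBelow, fun i hi => ?_⟩
            have := hf i
            have := hne i hi
            unfold Near
            omega
        have hcard : A.card ≤ (A.filter fun i => f i ≠ d).card + 1 := by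
          rw [← Finset.card_filter_add_card_filter_not (s := A) (fun i => f i ≠ d)]
          refine Nat.add_le_add_left (Finset.card_le_one.2 fun i hi j hj => hinj ?_) _
          simp only [Finset.mem_filter, not_not] at hi hj
          rw [hi.2, hj.2]
        generalize hB : A.filter (fun i => f i ≠ d) = B at hcard
        -- With a single free robber, `hk` would read `k + 1 < 1`.
        have hA2 : 2 ≤ A.card := by
          by_contra h
          rw [show A.card - 1 = 0 by omega] at hk
          omega
        refine ⟨B, fun _ => ⟨s, hs1, hsn⟩, fun i => by simp [← hB], fun i hi => ⟨?_, ?_⟩, ?_⟩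
        · rw [← hB, Finset.mem_filter] at hi
          exact (step_graphH_iff _ _).2 (hnear i hi.2)
        · exact ne_of_safe hsafe
        · refine ih₁ d ⟨s, hs1, hsn⟩ B (n - 4 + ℓ) (Finset.card_pos.1 (by omega)) (by omega)
            hsafe ?_
          have h1 : (A.card - 1) * (n - 4 + ℓ) ≤ (B.card - 1 + 1) * (n - 4 + ℓ) :=
            Nat.mul_le_mul_right _ (by omega)
          rw [Nat.succ_mul] at h1
          omega
      · have hfd : ∀ i, f i ≠ d := by
          intro i h
          have := hf i
          rw [h] at this
          exact hcap this
        by_cases hdn : (d : ℕ) + 4 = n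
        · exact ⟨A, f, fun i => by simp [hfd i], fun i _ => ⟨Or.inl rfl, hfd i⟩,
            ih₂ d A f hdn hA hinj hf (by omega)⟩
        -- The cop has stepped back to `n - 5`, `n - 7` or `n - 8`; the robbers reunite at `n`, so
        -- her retreat gains nothing.
        · have hsafe : Safe n d n 2 := by
            have : (d : ℕ) + 5 = n ∨ (d : ℕ) + 7 = n ∨ (d : ℕ) + 8 = n := by
              unfold Near at hd
              omega
            rcases this with h | h | h
            · exact .fiveAbove
            · exact .sevenAbove
            · exact .eightAbove
          refine ⟨A, fun _ => ⟨n, by omega, le_rfl⟩, fun i => by simp [hfd i],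
            fun i _ => ⟨?_, ne_of_safe hsafe⟩, ih₁ d ⟨n, by omega, le_rfl⟩ A 2 hA le_rfl hsafe
              (by omega)⟩
          rw [step_graphH_iff]
          have := hf i
          unfold Near
          dsimp only
          omega

theorem le_captureTime_graphH {n ℓ : ℕ} (hℓ : 2 ≤ ℓ) (hn : n = 4 * ℓ + 2) :
    ((2 * ℓ + 3 * (n - 4) : ℕ) : ℕ∞) ≤ captureTime (graphH n) 3 := by
  obtain ⟨k, hk⟩ : ∃ k, 2 * ℓ + 3 * (n - 4) = k + 1 := ⟨2 * ℓ + 3 * (n - 4) - 1, by omega⟩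
  rw [hk, Nat.cast_succ]
  refine Order.add_one_le_of_lt (lt_captureTime fun s => ?_)
  obtain ⟨r, hr, hr', hs⟩ := exists_safe (by omega : 10 ≤ n) s.2.1 s.2.2
  refine ⟨arrangement s Finset.univ fun _ => ⟨r, hr, hr'⟩, ⟨rfl, fun i => ⟨⟨r, hr, hr'⟩, ?_⟩⟩,
    (not_copWins_graphH hℓ hn k).1 s ⟨r, hr, hr'⟩ _ (n - 4) Finset.univ_nonempty (by omega) hs ?_⟩
  · have : (⟨r, hr, hr'⟩ : (Set.Icc 1 n : Set ℕ)) ≠ s := by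
      rintro rfl
      exact hs.not_near (Or.inl rfl)
    simp [arrangement, status, this]
  · rw [Finset.card_univ, Fintype.card_fin]
    omega

/-! ### Upper bound: chasing a single robber -/

/-- The cop, at `c` and to move, can capture a robber at `r` within `v` rounds. -/
inductive Doomed (n c r v : ℕ) : Prop
  | near (hcr : Near c r) (hv : 1 ≤ v := by omega)
  | twoAbove (hc : c = 2 := by omega) (hr : 4 ≤ r := by omega) (hm : r % 4 = 0 := by omega)
      (hv : n ≤ v + 4 := by omega)
  | sixAbove (hc : c = 1 := by omega) (hr : 7 ≤ r := by omega) (hm : r % 4 = 3 := by omega)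
      (hv : n ≤ v + 5 := by omega)
  | fiveAbove (hr : c + 5 ≤ r := by omega) (hm : (r - c) % 4 = 1 := by omega)
      (hv : n ≤ v + c + 3 := by omega)
  | sevenAbove (hr : c + 7 ≤ r := by omega) (hm : (r - c) % 4 = 3 := by omega)
      (hv : n ≤ v + c + 5 := by omega)
  | eightAbove (hr : c + 8 ≤ r := by omega) (hm : (r - c) % 4 = 0 := by omega)
      (hv : n ≤ v + c + 6 := by omega)

theorem Doomed.pos {n c r v : ℕ} (hn : 10 ≤ n) (hr : r ≤ n) (h : Doomed n c r v) : 1 ≤ v := by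
  cases h <;> omega

/-- A robber leaving `r` changes his residue relative to the shadow `d` by 0 or ±1. So either he
lands near `d`, or a cop move of 4, 1 or 3 upwards recovers the shadow; an advance of 1 is her
slowest, and it fixes the bound. -/
theorem Doomed.of_shadow {n d r s v : ℕ} (hr : d + 4 ≤ r)
    (hm : (r - d) % 4 = 0) (hv : n ≤ v + d + 3) (hr' : r ≤ n) (hrs : Near r s) :
    Doomed n d s v := by
  by_cases hds : Near d s
  · exact .near hds
  · have h : d + 5 ≤ s ∧ ((s - d) % 4 = 1 ∨ (s - d) % 4 = 3 ∨ (s - d) % 4 = 0) := by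
      unfold Near at hds hrs
      omega
    obtain ⟨h5, h | h | h⟩ := h
    · exact .fiveAbove
    · exact .sevenAbove
    · exact .eightAbove

theorem Doomed.exists_move {n c r v : ℕ} (hn : 10 ≤ n) (hc : 1 ≤ c) (hr₁ : 1 ≤ r) (hr' : r ≤ n)
    (h : Doomed n c r (v + 1)) :
    ∃ d, 1 ≤ d ∧ d ≤ n ∧ Near c d ∧
      (r = d ∨ ∀ s, 1 ≤ s → s ≤ n → Near r s → Doomed n d s v) := by
  cases h with
  | near hcr hv => exact ⟨r, hr₁, hr', hcr, Or.inl rfl⟩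
  | twoAbove hc hr hm hv =>
    refine ⟨1, by omega, by omega, by unfold Near; omega, Or.inr fun s hs hs' hrs => ?_⟩
    by_cases hds : Near 1 s
    · exact .near hds
    · have h : 7 ≤ s ∧ (s % 4 = 3 ∨ s % 4 = 0 ∨ s % 4 = 1) := by
        unfold Near at hds hrs
        omega
      obtain ⟨h7, h | h | h⟩ := h
      · exact .sixAbove
      · exact .sevenAbove
      · exact .eightAbove
  | sixAbove hc hr hm hv =>
    exact ⟨3, by omega, by omega, by unfold Near; omega, Or.inr fun s _ _ hrs =>
      .of_shadow (by omega) (by omega) (by omega) hr' hrs⟩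
  | fiveAbove hr hm hv =>
    exact ⟨c + 1, by omega, by omega, by unfold Near; omega, Or.inr fun s _ _ hrs =>
      .of_shadow (by omega) (by omega) (by omega) hr' hrs⟩
  | sevenAbove hr hm hv =>
    exact ⟨c + 3, by omega, by omega, by unfold Near; omega, Or.inr fun s _ _ hrs =>
      .of_shadow (by omega) (by omega) (by omega) hr' hrs⟩
  | eightAbove hr hm hv =>
    exact ⟨c + 4, by omega, by omega, by unfold Near; omega, Or.inr fun s _ _ hrs =>
      .of_shadow (by omega) (by omega) (by omega) hr' hrs⟩

/-- From 2, a robber out of reach can be shadowed in one move unless his label is 0 mod 4; then the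
cop detours through 1 to make use of the edge 13. -/
theorem doomed_two {n r : ℕ} (hn : 10 ≤ n) (hr : 1 ≤ r) : Doomed n 2 r (n - 4) := by
  by_cases h2 : Near 2 r
  · exact .near h2
  · have h : 4 ≤ r ∧ (r % 4 = 0 ∨ (7 ≤ r ∧ r % 4 = 3) ∨ (9 ≤ r ∧ r % 4 = 1) ∨
        (10 ≤ r ∧ r % 4 = 2)) := by
      unfold Near at h2
      omega
    obtain ⟨h4, h | h | h | h⟩ := h
    · exact .twoAbove
    · exact .fiveAbove
    · exact .sevenAbove
    · exact .eightAbove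

/-! ### Upper bound: repeated chases with returns to 2 -/

section FreeCount

variable {V : Type*} {G : SimpleGraph V} {m : ℕ}

open Classical in

/-- The number of robbers that are still free. -/
noncomputable def freeCount (p : Position V m) : ℕ :=
  (Finset.univ.filter fun i => p.robber i ≠ none).card

theorem forall_none_of_freeCount_eq_zero {p : Position V m} (h : freeCount p = 0) :
    ∀ i, p.robber i = none := by
  intro i
  by_contra hi
  have := Finset.filter_eq_empty_iff.1 (Finset.card_eq_zero.1 h) (Finset.mem_univ i)
  exact this hi

theorem freeCount_le_of_robberMove {c : V} {p p' : Position V m}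
    (h : ∀ i, RobberMove G c (p.robber i) (p'.robber i)) : freeCount p' ≤ freeCount p := by
  refine Finset.card_le_card fun i hi => ?_
  simp only [Finset.mem_filter, Finset.mem_univ, true_and] at hi ⊢
  intro hn
  have := h i
  rw [hn] at this
  exact hi this

theorem freeCount_lt_of_robberMove {c : V} {p p' : Position V m}
    (h : ∀ i, RobberMove G c (p.robber i) (p'.robber i)) {i : Fin m} (hi : p.robber i ≠ none)
    (hi' : p'.robber i = none) : freeCount p' < freeCount p := by
  refine Finset.card_lt_card (Finset.ssubset_iff_subset_ne.2 ⟨fun j hj => ?_, fun heq => ?_⟩)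
  · simp only [Finset.mem_filter, Finset.mem_univ, true_and] at hj ⊢
    intro hn
    have := h j
    rw [hn] at this
    exact hj this
  · have : i ∈ Finset.univ.filter fun i => p.robber i ≠ none := by simp [hi]
    rw [← heq] at this
    simp [hi'] at this

end FreeCount

/-- The cop pursues robber `i` alone. Incidental captures only lower `freeCount`, and `K` rounds
remain once `i` is caught. -/
theorem copWins_of_doomed {n m K : ℕ} (hn : 10 ≤ n) (v : ℕ) :
    ∀ (p : Position (Set.Icc 1 n : Set ℕ) m) (i : Fin m) (r : (Set.Icc 1 n : Set ℕ)),
      p.robber i = some r → Doomed n p.cop r v →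
      (∀ p' : Position (Set.Icc 1 n : Set ℕ) m, freeCount p' < freeCount p →
        CopWins (graphH n) K p') → CopWins (graphH n) (K + v) p := by
  induction v with
  | zero =>
    intro p i r _ hd _
    exact absurd (hd.pos hn r.2.2) (by omega)
  | succ v ih =>
    intro p i r hr hd hK
    obtain ⟨d, hd1, hdn, hcd, hmove⟩ := hd.exists_move hn p.cop.2.1 r.2.1 r.2.2
    refine Or.inr ⟨⟨d, hd1, hdn⟩, (step_graphH_iff _ _).2 hcd, fun p' hp' hrob => ?_⟩
    have hnone : p'.robber i = none → CopWins (graphH n) (K + v) p' := fun h =>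
      (hK p' (freeCount_lt_of_robberMove hrob (by simp [hr]) h)).mono (by omega)
    have hi := hrob i
    rw [hr] at hi
    rcases hi with ⟨_, hi⟩ | ⟨hne, w, hw, hi⟩
    · exact hnone hi
    · by_cases hwd : w = ⟨d, hd1, hdn⟩
      · exact hnone (by rw [hi, status, if_pos hwd])
      · rw [status, if_neg hwd] at hi
        rcases hmove with h | h
        · exact absurd (Subtype.ext h) hne
        · refine ih p' i w hi ?_ fun p'' hp'' =>
            hK p'' (hp''.trans_le (freeCount_le_of_robberMove hrob))
          rw [hp']
          exact h w w.2.1 w.2.2 ((step_graphH_iff _ _).1 hw)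

/-- Descending by 4 is the rule. The exception is 4, which is not adjacent to 2 and needs two moves,
so from 8 the cop goes to 5 instead. -/
theorem exists_near_toward_two {c k : ℕ} (hc : 1 ≤ c) (hk : c ≤ 4 * (k + 1) + 2)
    (h4 : c = 4 → 1 ≤ k) :
    ∃ d, 1 ≤ d ∧ (d ≤ c ∨ d = 2) ∧ Near c d ∧ d ≤ 4 * k + 2 ∧ (k = 0 → d = 2) ∧ (d = 4 → 2 ≤ k) := by
  unfold Near
  by_cases h9 : 9 ≤ c
  · exact ⟨c - 4, by omega⟩
  by_cases h7 : 7 ≤ c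
  · obtain rfl | rfl : c = 7 ∨ c = 8 := by omega
    · exact ⟨3, by omega⟩
    · exact ⟨5, by omega⟩
  by_cases h : c = 4
  · exact ⟨3, by omega⟩
  · exact ⟨2, by omega⟩

theorem copWins_of_return {n m K : ℕ} (k : ℕ) :
    ∀ p : Position (Set.Icc 1 n : Set ℕ) m, (p.cop : ℕ) ≤ 4 * k + 2 →
      (k = 0 → (p.cop : ℕ) = 2) → ((p.cop : ℕ) = 4 → 2 ≤ k) → 2 ≤ n →
      (∀ p' : Position (Set.Icc 1 n : Set ℕ) m, (p'.cop : ℕ) = 2 → freeCount p' ≤ freeCount p →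
        CopWins (graphH n) K p') → CopWins (graphH n) (K + k) p := by
  induction k with
  | zero =>
    intro p _ h2 _ _ hK
    exact hK p (h2 rfl) le_rfl
  | succ k ih =>
    intro p hle _ h4 hn hK
    obtain ⟨d, hd1, hdc, hcd, hd, hd0, hd4⟩ :=
      exists_near_toward_two p.cop.2.1 hle (fun h => by have := h4 h; omega)
    have hdn : d ≤ n := by
      have := p.cop.2.2
      omega
    refine Or.inr ⟨⟨d, hd1, hdn⟩, (step_graphH_iff _ _).2 hcd, fun p' hp' hrob => ?_⟩
    refine ih p' (by rw [hp']; exact hd) (by rw [hp']; exact hd0) (by rw [hp']; exact hd4) hn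
      fun p'' h2 hp'' => hK p'' h2 (hp''.trans (freeCount_le_of_robberMove hrob))

/-- Each of the first `j` chases is paid for together with a return of `ℓ` rounds; the last chase
needs no return. -/
theorem copWins_of_cop_eq_two {n ℓ m : ℕ} (hℓ : 2 ≤ ℓ) (hn : n = 4 * ℓ + 2) (j : ℕ) :
    ∀ p : Position (Set.Icc 1 n : Set ℕ) m, (p.cop : ℕ) = 2 → freeCount p ≤ j + 1 →
      CopWins (graphH n) (j * (n - 4 + ℓ) + (n - 4)) p := by
  induction j with
  | zero =>
    intro p h2 hp
    by_cases hi : ∃ i, p.robber i ≠ none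
    · obtain ⟨i, hi⟩ := hi
      obtain ⟨r, hr⟩ := Option.ne_none_iff_exists'.1 hi
      rw [Nat.zero_mul]
      refine copWins_of_doomed (by omega) _ p i r hr (h2 ▸ doomed_two (by omega) r.2.1) ?_
      exact fun p' hp' => forall_none_of_freeCount_eq_zero (by omega)
    · push Not at hi
      exact copWins_of_forall_none hi _
  | succ j ih =>
    intro p h2 hp
    by_cases hi : ∃ i, p.robber i ≠ none
    · obtain ⟨i, hi⟩ := hi
      obtain ⟨r, hr⟩ := Option.ne_none_iff_exists'.1 hi
      refine copWins_of_doomed (by omega) _ p i r hr (h2 ▸ doomed_two (by omega) r.2.1) ?_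
      intro p' hp'
      rw [Nat.succ_mul, ← add_assoc]
      refine copWins_of_return ℓ p' (hn ▸ p'.cop.2.2) (by omega) (by omega) (by omega) ?_
      exact fun p'' h2 hp'' => ih p'' h2 (by omega)
    · push Not at hi
      exact copWins_of_forall_none hi _

theorem captureTime_graphH_le {n ℓ : ℕ} (hℓ : 2 ≤ ℓ) (hn : n = 4 * ℓ + 2) :
    captureTime (graphH n) 3 ≤ ((2 * ℓ + 3 * (n - 4) : ℕ) : ℕ∞) := by
  refine captureTime_le ⟨2, by omega, by omega⟩ fun p hp => ?_
  have h3 : freeCount p ≤ 2 + 1 := (Finset.card_le_univ _).trans (by simp)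
  exact (copWins_of_cop_eq_two hℓ hn 2 p (by rw [hp.1]) h3).mono (by omega)

end CopsRobbers

theorem mainTheorem3 (n ℓ : ℕ) (hℓ : 2 ≤ ℓ) (hn : n = 4 * ℓ + 2) :
    CopsRobbers.captureTime (CopsRobbers.graphH n) 3 = ((2 * ℓ + 3 * (n - 4) : ℕ) : ℕ∞) :=
  le_antisymm (CopsRobbers.captureTime_graphH_le hℓ hn) (CopsRobbers.le_captureTime_graphH hℓ hn)
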